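/- Let $\mathcal H_a,\mathcal H_b$ be finite-dimensional complex Hilbert spaces, and let $\Pi^1,\Pi^2$ be mutually orthogonal projectors on $\mathcal H_a$ with $\Pi^1+\Pi^2=\mathbb 1$. For $x\in\mathbb R$ put $$\tau_1=\sqrt{\tfrac{1-\tanh x}{2}},\quad \tau_2=\sqrt{\tfrac{1+\tanh x}{2}},\quad \Omega_x=\tau_1\Pi^1+\tau_2\Pi^2,\quad \Omega_{-x}=\tau_2\Pi^1+\tau_1\Pi^2 ,$$ and for operators $X$ on $\mathcal H_a\otimes\mathcal H_b$ let $$\Omega(X)=\sum_{k=\pm x}(\Omega_k\otimes\mathbb 1)X(\Omega_k\otimes\mathbb 1),\qquad \Pi^a(X)=\sum_{k=1,2}(\Pi^k\otimes\mathbb 1)X(\Pi^k\otimes\mathbb 1).$$ For a state (density operator) $\rho$ on $\mathcal H_a\otimes\mathcal H_b$ define the coherence relative to the weak measurement by $$C_H(\rho|\Omega)=\big\|\sqrt\rho-\Omega(\sqrt\rho)\big\|^2,\qquad \|O\|=\sqrt{\operatorname{tr}(O^\dagger O)},$$ and let $\mathcal I_p=\{\sigma \text{ a state}:\Pi^a(\sigma)=\sigma\}$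 be the set of partially incoherent states. Strong monotonicity: let $\{A_k\}$ be a finite family of operators on $\mathcal H_a\otimes\mathcal H_b$ with $\sum_kA_k^\dagger A_k=\mathbb 1$ that are partially incoherent, i.e. for every $k$ and every $\sigma\in\mathcal I_p$ with $\operatorname{tr}(A_k\sigma A_k^\dagger)\neq 0$ one has $A_k\sigma A_k^\dagger/\operatorname{tr}(A_k\sigma A_k^\dagger)\in\mathcal I_p$. Then for every state $\rho$ on $\mathcal H_a\otimes\mathcal H_b$, $$C_H(\rho|\Omega)\;\ge\;\sum_k p_k\,C_H(\rho_k|\Omega),\qquad p_k=\operatorname{tr}(A_k\rho A_k^\dagger),\quad \rho_k=A_k\rho A_k^\dagger/p_k,$$ where terms with $p_k=0$ are counted as $0$. -/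

import Mathlib

open scoped Kronecker Matrix MatrixOrder ComplexOrder

noncomputable section

namespace WeakCoherence

/-- Density matrices on the Hilbert space with orthonormal basis indexed by `n`. -/
def IsState {n : Type*} [Fintype n] (ρ : Matrix n n ℂ) : Prop :=
  ρ.PosSemidef ∧ ρ.trace = 1

/-- The Hilbert-Schmidt norm `‖O‖ = √(tr (O† O))`. -/
def hsNorm {n : Type*} [Fintype n] (O : Matrix n n ℂ) : ℝ :=
  Real.sqrt (Oᴴ * O).trace.re

/-- A pair `P 0, P 1` of mutually orthogonal (self-adjoint) projectors on the subsystem `a`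
with `P 0 + P 1 = 1`. -/
structure IsTwoOutcomeProjective {a : Type*} [Fintype a] [DecidableEq a]
    (P : Fin 2 → Matrix a a ℂ) : Prop where
  isHermitian : ∀ i, (P i).IsHermitian
  idempotent : ∀ i, P i * P i = P i
  orthogonal : ∀ i j, i ≠ j → P i * P j = 0
  sum_eq_one : P 0 + P 1 = 1

/-- The local projective measurement `Π^a(X) = ∑ₖ (Πₖ ⊗ 1) X (Πₖ ⊗ 1)`. -/
def localMeasurement {a b : Type*} [Fintype a] [Fintype b] [DecidableEq b]
    (P : Fin 2 → Matrix a a ℂ) (X : Matrix (a × b) (a × b) ℂ) :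
    Matrix (a × b) (a × b) ℂ :=
  ∑ k, (P k ⊗ₖ (1 : Matrix b b ℂ)) * X * (P k ⊗ₖ (1 : Matrix b b ℂ))

/-- The coefficient `τ₁ = √((1 - tanh x) / 2)`. -/
def tau1 (x : ℝ) : ℝ := Real.sqrt ((1 - Real.tanh x) / 2)

/-- The coefficient `τ₂ = √((1 + tanh x) / 2)`. -/
def tau2 (x : ℝ) : ℝ := Real.sqrt ((1 + Real.tanh x) / 2)

/-- The weak measurement operator `Ωₓ = τ₁ Π¹ + τ₂ Π²`. -/
def weakOpPos {a : Type*} (P : Fin 2 → Matrix a a ℂ) (x : ℝ) : Matrix a a ℂ :=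
  (tau1 x : ℂ) • P 0 + (tau2 x : ℂ) • P 1

/-- The weak measurement operator `Ω₋ₓ = τ₂ Π¹ + τ₁ Π²`. -/
def weakOpNeg {a : Type*} (P : Fin 2 → Matrix a a ℂ) (x : ℝ) : Matrix a a ℂ :=
  (tau2 x : ℂ) • P 0 + (tau1 x : ℂ) • P 1

/-- The weak measurement map `Ω(X) = ∑_{k = ±x} (Ωₖ ⊗ 1) X (Ωₖ ⊗ 1)`. -/
def weakMeasurement {a b : Type*} [Fintype a] [Fintype b] [DecidableEq b]
    (P : Fin 2 → Matrix a a ℂ) (x : ℝ) (X : Matrix (a × b) (a × b) ℂ) :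
    Matrix (a × b) (a × b) ℂ :=
  (weakOpPos P x ⊗ₖ (1 : Matrix b b ℂ)) * X * (weakOpPos P x ⊗ₖ (1 : Matrix b b ℂ)) +
    (weakOpNeg P x ⊗ₖ (1 : Matrix b b ℂ)) * X * (weakOpNeg P x ⊗ₖ (1 : Matrix b b ℂ))

/-- The coherence relative to the weak measurement,
`C_H(ρ|Ω) = ‖√ρ - Ω(√ρ)‖²`. -/
def weakCoherence {a b : Type*} [Fintype a] [DecidableEq a] [Fintype b] [DecidableEq b]
    (P : Fin 2 → Matrix a a ℂ) (x : ℝ) (ρ : Matrix (a × b) (a × b) ℂ) : ℝ :=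
  hsNorm (CFC.sqrt ρ - weakMeasurement P x (CFC.sqrt ρ)) ^ 2

/-- The set `I_p` of partially incoherent states: states `ρ` with `Π^a(ρ) = ρ`. -/
def partiallyIncoherentStates {a b : Type*} [Fintype a] [Fintype b] [DecidableEq b]
    (P : Fin 2 → Matrix a a ℂ) : Set (Matrix (a × b) (a × b) ℂ) :=
  {ρ | IsState ρ ∧ localMeasurement P ρ = ρ}

/-- The probability `tr (A ρ A†)` of the outcome with Kraus operator `A`. -/
def outcomeProb {n : Type*} [Fintype n] (A ρ : Matrix n n ℂ) : ℝ :=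
  (A * ρ * Aᴴ).trace.re

/-- The post-selected state `A ρ A† / tr (A ρ A†)` (meaningful for nonzero probability). -/
def outcomeState {n : Type*} [Fintype n] (A ρ : Matrix n n ℂ) : Matrix n n ℂ :=
  ((outcomeProb A ρ)⁻¹ : ℂ) • (A * ρ * Aᴴ)

/-- Kraus operators of a partially incoherent operation: the map `ρ ↦ ∑ₖ Aₖ ρ Aₖ†` is trace
preserving, and every `Aₖ` sends partially incoherent states to partially incoherent states
(after normalisation, whenever the outcome has nonzero probability). -/
structure IsPartiallyIncoherentKraus {a b ι : Type*} [Fintype a] [DecidableEq a] [Fintype b]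
    [DecidableEq b] [Fintype ι] (P : Fin 2 → Matrix a a ℂ)
    (A : ι → Matrix (a × b) (a × b) ℂ) : Prop where
  tracePreserving : ∑ k, (A k)ᴴ * A k = 1
  incoherent : ∀ k, ∀ σ ∈ partiallyIncoherentStates (b := b) P,
    outcomeProb (A k) σ ≠ 0 → outcomeState (A k) σ ∈ partiallyIncoherentStates (b := b) P

end WeakCoherence

end

/-!
The map `1 - Ω` is `1 - 2 τ₁ τ₂` times the projection `1 - Π` onto off-diagonal blocks, so
`C_H(ρ|Ω) = (1 - 2 τ₁ τ₂)² (tr ρ - ‖Π √ρ‖²)`. This is homogeneous in `ρ`, and since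
`∑ₖ tr (Aₖ ρ Aₖ†) = tr ρ` the claim becomes `‖Π √ρ‖² ≤ ∑ₖ ‖Π √(Aₖ ρ Aₖ†)‖²`.

Among the incoherent `σ` with `tr σ = ‖Π √ρ‖²`, the affinity `tr (√ρ √σ)` is largest, equal to
`‖Π √ρ‖²`, at `σ = (Π √ρ)²`. For this `σ` the affinity is at most `∑ₖ tr (√(Aₖ ρ Aₖ†) √(Aₖ σ Aₖ†))`
(monotonicity of the affinity), and as `Aₖ σ Aₖ†` is again incoherent, each term is at most
`(‖Π √(Aₖ ρ Aₖ†)‖² + tr (Aₖ σ Aₖ†)) / 2`.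

Monotonicity of the affinity is Lieb's theorem for the exponent `1 / 2`. It follows from Pusz and
Woronowicz's characterisation of the geometric mean: for commuting positive `P` and `Q`, the product
`P Q` is the largest Hermitian `Y Z†` with `Y Y† ≤ P²` and `Z Z† ≤ Q²`. Here `P` and `Q` are
multiplication by the square roots on the left and on the right.
-/

noncomputable section

namespace WeakCoherence

open Matrix

section GeometricMean

variable {𝕜 n m : Type*} [RCLike 𝕜] [Fintype n]

-- Lyapunov: test the anticommutator on an eigenvector of `H`.
theorem posSemidef_of_posSemidef_anticommutator {G H : Matrix n n 𝕜} (hG : G.PosDef)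
    (hH : H.IsHermitian) (hGH : (G * H + H * G).PosSemidef) : H.PosSemidef := by
  classical
  refine hH.posSemidef_iff_eigenvalues_nonneg.2 fun i => ?_
  set v : n → 𝕜 := (hH.eigenvectorBasis i).ofLp with hv
  set μ := hH.eigenvalues i
  have hHv : H *ᵥ v = μ • v := hH.mulVec_eigenvectorBasis i
  have hvH : star v ᵥ* H = μ • star v := by
    rw [← star_inj, star_vecMul, hH.eq, star_star, hHv, star_smul, star_star, star_trivial]
  have hv0 : v ≠ 0 := by
    simpa [hv] using hH.eigenvectorBasis.orthonormal.ne_zero i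
  have hform : star v ⬝ᵥ (G * H + H * G) *ᵥ v = (2 * μ) • (star v ⬝ᵥ G *ᵥ v) := by
    rw [add_mulVec, dotProduct_add, ← mulVec_mulVec, ← mulVec_mulVec, hHv,
      dotProduct_mulVec _ H, hvH, mulVec_smul, dotProduct_smul, smul_dotProduct, two_mul, add_smul]
  have hpos : 0 < RCLike.re (star v ⬝ᵥ G *ᵥ v) := hG.re_dotProduct_pos hv0
  have hnonneg := hGH.re_dotProduct_nonneg v
  rw [hform, RCLike.smul_re] at hnonneg
  exact nonneg_of_mul_nonneg_right (nonneg_of_mul_nonneg_left hnonneg hpos) two_pos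

theorem posDef_mul_of_commute {P Q : Matrix n n 𝕜} (hP : P.PosDef) (hQ : Q.PosDef)
    (hPQ : Commute P Q) : (P * Q).PosDef := by
  classical
  exact (hPQ.mul_nonneg hP.posSemidef.nonneg hQ.posSemidef.nonneg).posSemidef.posDef_iff_isUnit.2
    (hP.isUnit.mul hQ.isUnit)

theorem posSemidef_of_commute_posDef {P Q H : Matrix n n 𝕜} (hP : P.PosDef) (hQ : Q.PosDef)
    (hPQ : Commute P Q) (hH : H.IsHermitian) (hPHQ : (P * H * Q + Q * H * P).PosSemidef) :
    H.PosSemidef := by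
  classical
  obtain ⟨u, rfl⟩ := hP.isUnit
  set v : Matrix n n 𝕜 := ↑u⁻¹
  have hv : v.PosDef := by simpa only [v, coe_units_inv] using hP.inv
  have hvQ : Commute v Q := hPQ.units_inv_left
  refine posSemidef_of_posSemidef_anticommutator (posDef_mul_of_commute hv hQ hvQ) hH ?_
  have hconj : vᴴ * (u * H * Q + Q * H * u) * v = v * Q * H + H * (v * Q) := by
    rw [hv.isHermitian.eq, mul_add, add_mul, add_comm]
    congr 1
    · simp only [← mul_assoc, v, Units.mul_inv_cancel_right]
    · simp only [mul_assoc, v, Units.inv_mul_cancel_left, hvQ.eq]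
  exact hconj ▸ hPHQ.conjTranspose_mul_mul_same v

variable [Fintype m]

theorem mul_conjTranspose_le_mul_of_posDef {P Q : Matrix n n 𝕜} {Y Z : Matrix n m 𝕜}
    (hP : P.PosDef) (hQ : Q.PosDef) (hPQ : Commute P Q) (hY : Y * Yᴴ ≤ P * P)
    (hZ : Z * Zᴴ ≤ Q * Q) (hYZ : (Y * Zᴴ).IsHermitian) : Y * Zᴴ ≤ P * Q := by
  have hZY : Z * Yᴴ = Y * Zᴴ := by
    rw [← hYZ.eq, conjTranspose_mul, conjTranspose_conjTranspose]
  have hsum : P * (P * Q - Y * Zᴴ) * Q + Q * (P * Q - Y * Zᴴ) * P =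
      (Q * Y - P * Z) * (Q * Y - P * Z)ᴴ + Q * (P * P - Y * Yᴴ) * Qᴴ
        + P * (Q * Q - Z * Zᴴ) * Pᴴ := by
    have hPP : Q * (P * P) * Q = P * (P * Q) * Q := by
      rw [← mul_assoc, ← hPQ.eq, mul_assoc P, ← hPQ.eq]
    have hQQ : P * (Q * Q) * P = Q * (P * Q) * P := by rw [← mul_assoc, hPQ.eq, mul_assoc Q, hPQ.eq]
    have hcross : P * Z * (Yᴴ * Q) = P * (Y * Zᴴ) * Q := by
      rw [← hZY]; simp only [Matrix.mul_assoc]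
    simp only [conjTranspose_sub, conjTranspose_mul, hP.isHermitian.eq, hQ.isHermitian.eq,
      Matrix.mul_sub, Matrix.sub_mul, hPP, hQQ, hcross]
    simp only [Matrix.mul_assoc]
    abel
  refine posSemidef_of_commute_posDef hP hQ hPQ
    ((posDef_mul_of_commute hP hQ hPQ).isHermitian.sub hYZ) ?_
  rw [hsum]
  exact ((posSemidef_self_mul_conjTranspose _).add (hY.mul_mul_conjTranspose_same Q)).add
    (hZ.mul_mul_conjTranspose_same P)

theorem mul_self_le_add_smul_one_mul_self [DecidableEq n] {P : Matrix n n 𝕜}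
    (hP : P.PosSemidef) {ε : ℝ} (hε : 0 ≤ ε) : P * P ≤ (P + ε • 1) * (P + ε • 1) := by
  have hsub : (P + ε • 1) * (P + ε • 1) - P * P = (2 * ε) • P + ε ^ 2 • (1 : Matrix n n 𝕜) := by
    simp only [add_mul, mul_add, smul_mul_assoc, mul_smul_comm, mul_one, one_mul]
    module
  rw [le_iff, hsub]
  exact (hP.smul (by positivity)).add (PosSemidef.one.smul (by positivity))

theorem mul_conjTranspose_le_mul {P Q : Matrix n n 𝕜} {Y Z : Matrix n m 𝕜}
    (hP : P.PosSemidef) (hQ : Q.PosSemidef) (hPQ : Commute P Q) (hY : Y * Yᴴ ≤ P * P)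
    (hZ : Z * Zᴴ ≤ Q * Q) (hYZ : (Y * Zᴴ).IsHermitian) : Y * Zᴴ ≤ P * Q := by
  classical
  have hPQherm : (P * Q).IsHermitian :=
    (hP.isHermitian.commute_iff hQ.isHermitian).1 hPQ
  refine .of_dotProduct_mulVec_nonneg (hPQherm.sub hYZ) fun x => ?_
  set q : ℝ → 𝕜 := fun ε => star x ⬝ᵥ ((P + ε • 1) * (Q + ε • 1) - Y * Zᴴ) *ᵥ x with hq
  have hlim : Filter.Tendsto q (nhdsWithin 0 (Set.Ioi 0)) (nhds (q 0)) :=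
    (Continuous.tendsto (by fun_prop) 0).mono_left nhdsWithin_le_nhds
  suffices h : 0 ≤ q 0 by simpa only [hq, zero_smul, add_zero] using h
  refine ge_of_tendsto hlim (eventually_nhdsWithin_of_forall fun ε (hε : 0 < ε) => ?_)
  have hone : (ε • (1 : Matrix n n 𝕜)).PosDef := PosDef.one.smul hε
  refine PosSemidef.dotProduct_mulVec_nonneg (mul_conjTranspose_le_mul_of_posDef
    (PosDef.posSemidef_add hP hone) (PosDef.posSemidef_add hQ hone) ?_
    (hY.trans (mul_self_le_add_smul_one_mul_self hP hε.le))
    (hZ.trans (mul_self_le_add_smul_one_mul_self hQ hε.le)) hYZ) x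
  refine .add_left (.add_right hPQ ?_) (.add_right ?_ ?_)
  exacts [.smul_right (.one_right _) ε, .smul_left (.one_left _) ε, .refl _]

end GeometricMean

section Stack

section Semiring

variable {ι m n l α : Type*}

/-- The block column matrix with blocks `B k`. Rows are indexed as in `Matrix.blockDiagonal`. For
Kraus operators `B k` it is the associated Stinespring isometry. -/
def stack (B : ι → Matrix m n α) : Matrix (m × ι) n α :=
  of fun i j => B i.2 i.1 j

variable [NonUnitalNonAssocSemiring α]

theorem stack_mul [Fintype m] (B : ι → Matrix l m α) (M : Matrix m n α) :
    stack B * M = stack fun k => B k * M := rfl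

variable [Fintype m] [Fintype ι]

theorem blockDiagonal_mul_stack [DecidableEq ι] (M : ι → Matrix l m α) (B : ι → Matrix m n α) :
    blockDiagonal M * stack B = stack fun k => M k * B k := by
  ext ⟨i, k⟩ j
  simp [stack, mul_apply, Fintype.sum_prod_type, blockDiagonal_apply]

theorem star_dotProduct_blockDiagonal_mulVec [Star α] [DecidableEq ι] (M : ι → Matrix m m α)
    (v : ι → m → α) :
    (star fun i : m × ι => v i.2 i.1) ⬝ᵥ blockDiagonal M *ᵥ (fun i => v i.2 i.1) =
      ∑ k, star (v k) ⬝ᵥ M k *ᵥ v k := by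
  simp [mulVec, dotProduct, Fintype.sum_prod_type_right, blockDiagonal_apply]

theorem conjTranspose_stack_mul_stack [Star α] (B : ι → Matrix m n α) (C : ι → Matrix m l α) :
    (stack B)ᴴ * stack C = ∑ k, (B k)ᴴ * C k := by
  ext i j
  simp [stack, mul_apply, Fintype.sum_prod_type_right, Matrix.sum_apply]

theorem conjTranspose_stack_mulVec [Star α] (B : ι → Matrix m n α) (v : ι → m → α) :
    (stack B)ᴴ *ᵥ (fun i => v i.2 i.1) = ∑ k, (B k)ᴴ *ᵥ v k := by
  ext i
  simp [stack, mulVec, dotProduct, Fintype.sum_prod_type_right]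

end Semiring

section Kronecker

variable {ι l m n p α : Type*} [CommSemiring α]

theorem sum_kronecker (s : Finset ι) (B : ι → Matrix l m α) (C : Matrix n p α) :
    (∑ k ∈ s, B k) ⊗ₖ C = ∑ k ∈ s, B k ⊗ₖ C :=
  LinearMap.map_sum₂ (kroneckerBilinear (R := α)) s B C

theorem kronecker_sum (s : Finset ι) (B : Matrix l m α) (C : ι → Matrix n p α) :
    B ⊗ₖ (∑ k ∈ s, C k) = ∑ k ∈ s, B ⊗ₖ C k :=
  map_sum (kroneckerBilinear (R := α) B) C s

end Kronecker

variable {ι m n l 𝕜 : Type*} [RCLike 𝕜]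

theorem posSemidef_blockDiagonal [Finite m] [Finite ι] [DecidableEq ι] {M : ι → Matrix m m 𝕜}
    (hM : ∀ k, (M k).PosSemidef) : (blockDiagonal M).PosSemidef := by
  have := Fintype.ofFinite m
  have := Fintype.ofFinite ι
  refine .of_dotProduct_mulVec_nonneg
    (isHermitian_blockDiagonal_iff.2 fun k => (hM k).isHermitian) fun x => ?_
  rw [star_dotProduct_blockDiagonal_mulVec M fun k i => x (i, k)]
  exact Finset.sum_nonneg fun k _ => (hM k).dotProduct_mulVec_nonneg _

theorem mul_conjTranspose_le_one [Fintype m] [DecidableEq m] [Fintype n] [DecidableEq n]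
    {C : Matrix m n 𝕜} (hC : Cᴴ * C = 1) : C * Cᴴ ≤ 1 := by
  have hidem : C * Cᴴ * (C * Cᴴ) = C * Cᴴ := by
    rw [Matrix.mul_assoc, ← Matrix.mul_assoc Cᴴ, hC, Matrix.one_mul]
  have hsq : 1 - C * Cᴴ = (1 - C * Cᴴ) * (1 - C * Cᴴ)ᴴ := by
    simp [mul_sub, sub_mul, hidem]
  exact le_iff.2 (hsq ▸ posSemidef_self_mul_conjTranspose _)

variable [Fintype ι] [DecidableEq ι] [Fintype m] [Fintype n] [DecidableEq n] [Finite l]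

theorem stack_mul_conjTranspose_le {C : ι → Matrix m n 𝕜} (hC : ∑ k, (C k)ᴴ * C k = 1)
    (B : ι → Matrix l m 𝕜) :
    stack (fun k => B k * C k) * (stack fun k => B k * C k)ᴴ ≤
      blockDiagonal fun k => B k * (B k)ᴴ := by
  classical
  have := Fintype.ofFinite l
  have h : stack C * (stack C)ᴴ ≤ 1 :=
    mul_conjTranspose_le_one ((conjTranspose_stack_mul_stack C C).trans hC)
  rw [← blockDiagonal_mul_stack, blockDiagonal_mul, ← blockDiagonal_conjTranspose, le_iff]
  convert PosSemidef.mul_mul_conjTranspose_same h (blockDiagonal B) using 1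
  simp only [Matrix.mul_sub, Matrix.sub_mul, conjTranspose_mul, Matrix.mul_one, Matrix.mul_assoc]

variable {p : Type*} [Fintype p] [DecidableEq m]

theorem stack_kronecker_mul_conjTranspose_le_one_kronecker {C : ι → Matrix m n 𝕜}
    (hC : ∑ k, (C k)ᴴ * C k = 1) (B : ι → Matrix l p 𝕜) :
    stack (fun k => C k ⊗ₖ B k) * (stack fun k => C k ⊗ₖ B k)ᴴ ≤
      blockDiagonal fun k => (1 : Matrix m m 𝕜) ⊗ₖ (B k * (B k)ᴴ) := by
  classical
  have hC' : ∑ k, (C k ⊗ₖ (1 : Matrix p p 𝕜))ᴴ * C k ⊗ₖ (1 : Matrix p p 𝕜) = 1 := by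
    simp only [conjTranspose_kronecker, conjTranspose_one, ← mul_kronecker_mul, mul_one,
      ← sum_kronecker, hC, one_kronecker_one]
  simpa [← mul_kronecker_mul, conjTranspose_kronecker] using
    stack_mul_conjTranspose_le hC' fun k => (1 : Matrix m m 𝕜) ⊗ₖ B k

theorem stack_kronecker_mul_conjTranspose_le_kronecker_one {C : ι → Matrix m n 𝕜}
    (hC : ∑ k, (C k)ᴴ * C k = 1) (B : ι → Matrix l p 𝕜) :
    stack (fun k => B k ⊗ₖ C k) * (stack fun k => B k ⊗ₖ C k)ᴴ ≤
      blockDiagonal fun k => (B k * (B k)ᴴ) ⊗ₖ (1 : Matrix m m 𝕜) := by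
  classical
  have hC' : ∑ k, ((1 : Matrix p p 𝕜) ⊗ₖ C k)ᴴ * (1 : Matrix p p 𝕜) ⊗ₖ C k = 1 := by
    simp only [conjTranspose_kronecker, conjTranspose_one, ← mul_kronecker_mul, mul_one,
      ← kronecker_sum, hC, one_kronecker_one]
  simpa [← mul_kronecker_mul, conjTranspose_kronecker] using
    stack_mul_conjTranspose_le hC' fun k => B k ⊗ₖ (1 : Matrix m m 𝕜)

end Stack

section Affinity

section KroneckerProduct

variable {ι m n m' n' 𝕜 : Type*} [RCLike 𝕜] [Fintype ι] [DecidableEq ι] [Fintype m] [Fintype n]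
  [DecidableEq n] [Fintype m'] [Fintype n'] [DecidableEq n']

theorem stack_kronecker_mul_kronecker_mul_conjTranspose_le {A : ι → Matrix m n 𝕜}
    {B : ι → Matrix m' n' 𝕜} (hA : ∑ k, (A k)ᴴ * A k = 1) (hB : ∑ k, (B k)ᴴ * B k = 1)
    {R : Matrix n n 𝕜} {D : Matrix n' n' 𝕜} (hR : R.IsHermitian) (hD : D.IsHermitian)
    {R' : ι → Matrix m m 𝕜} {D' : ι → Matrix m' m' 𝕜}
    (hR' : ∀ k, (R' k).PosSemidef) (hD' : ∀ k, (D' k).PosSemidef)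
    (hRR' : ∀ k, R' k * R' k = A k * (R * R) * (A k)ᴴ)
    (hDD' : ∀ k, D' k * D' k = B k * (D * D) * (B k)ᴴ) :
    stack (fun k => B k ⊗ₖ A k) * (D ⊗ₖ R) * (stack fun k => B k ⊗ₖ A k)ᴴ ≤
      blockDiagonal fun k => D' k ⊗ₖ R' k := by
  classical
  set S := stack fun k => B k ⊗ₖ A k with hS
  set Y := S * ((1 : Matrix n' n' 𝕜) ⊗ₖ R) with hYdef
  set Z := S * (D ⊗ₖ (1 : Matrix n n 𝕜)) with hZdef
  set P := blockDiagonal fun k => (1 : Matrix m' m' 𝕜) ⊗ₖ R' k with hP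
  set Q := blockDiagonal fun k => D' k ⊗ₖ (1 : Matrix m m 𝕜) with hQ
  have hY : Y * Yᴴ ≤ P * P := by
    have := stack_kronecker_mul_conjTranspose_le_one_kronecker hB fun k => A k * R
    simpa only [hYdef, hS, hP, stack_mul, ← blockDiagonal_mul, ← mul_kronecker_mul, Matrix.mul_one,
      hRR', conjTranspose_mul, hR.eq, Matrix.mul_assoc]
  have hZ : Z * Zᴴ ≤ Q * Q := by
    have := stack_kronecker_mul_conjTranspose_le_kronecker_one hA fun k => B k * D
    simpa only [hZdef, hS, hQ, stack_mul, ← blockDiagonal_mul, ← mul_kronecker_mul, Matrix.mul_one,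
      hDD', conjTranspose_mul, hD.eq, Matrix.mul_assoc]
  have hYZ : Y * Zᴴ = S * (D ⊗ₖ R) * Sᴴ := by
    rw [hYdef, hZdef, conjTranspose_mul, conjTranspose_kronecker, hD.eq, conjTranspose_one,
      ← Matrix.mul_assoc, Matrix.mul_assoc S, ← mul_kronecker_mul, Matrix.one_mul, Matrix.mul_one]
  have hDR : (D ⊗ₖ R).IsHermitian := by rw [IsHermitian, conjTranspose_kronecker, hD.eq, hR.eq]
  have hPQ : P * Q = blockDiagonal fun k => D' k ⊗ₖ R' k := by
    simp only [hP, hQ, ← blockDiagonal_mul, ← mul_kronecker_mul, Matrix.mul_one, Matrix.one_mul]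
  have hQP : Q * P = blockDiagonal fun k => D' k ⊗ₖ R' k := by
    simp only [hP, hQ, ← blockDiagonal_mul, ← mul_kronecker_mul, Matrix.mul_one, Matrix.one_mul]
  rw [← hYZ, ← hPQ]
  exact mul_conjTranspose_le_mul
    (posSemidef_blockDiagonal fun k => PosSemidef.one.kronecker (hR' k))
    (posSemidef_blockDiagonal fun k => (hD' k).kronecker PosSemidef.one)
    (hPQ.trans hQP.symm) hY hZ (hYZ ▸ isHermitian_mul_mul_conjTranspose S hDR)

end KroneckerProduct

variable {ι m n 𝕜 : Type*} [RCLike 𝕜] [Fintype ι] [Fintype m] [Fintype n] [DecidableEq n]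

theorem trace_mul_le_sum_trace_mul {A : ι → Matrix m n 𝕜} (hA : ∑ k, (A k)ᴴ * A k = 1)
    {R D : Matrix n n 𝕜} (hR : R.IsHermitian) (hD : D.IsHermitian) {R' D' : ι → Matrix m m 𝕜}
    (hR' : ∀ k, (R' k).PosSemidef) (hD' : ∀ k, (D' k).PosSemidef)
    (hRR' : ∀ k, R' k * R' k = A k * (R * R) * (A k)ᴴ)
    (hDD' : ∀ k, D' k * D' k = A k * (D * D) * (A k)ᴴ) :
    (R * D).trace ≤ ∑ k, (R' k * D' k).trace := by
  classical
  -- On `vec 1` the quadratic form of `Dᵀ ⊗ₖ R` is `tr (R D)`, so pass to `Dᵀ` and the conjugate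
  -- Kraus operators `(A k)ᵀᴴ` on the left factor.
  have hAt : ∑ k, (A k)ᵀᴴᴴ * (A k)ᵀᴴ = 1 := by
    simpa only [transpose_sum, transpose_mul, transpose_one, conjTranspose_conjTranspose,
      conjTranspose_transpose_eq_transpose_conjTranspose] using congrArg transpose hA
  have hDDt : ∀ k, (D' k)ᵀ * (D' k)ᵀ = (A k)ᵀᴴ * (Dᵀ * Dᵀ) * (A k)ᵀᴴᴴ := fun k => by
    rw [← transpose_mul, hDD']
    simp only [transpose_mul, conjTranspose_conjTranspose,
      conjTranspose_transpose_eq_transpose_conjTranspose, Matrix.mul_assoc]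
  have hle := stack_kronecker_mul_kronecker_mul_conjTranspose_le hA hAt hR hD.transpose hR'
    (fun k => (hD' k).transpose) hRR' hDDt
  set S := stack fun k => (A k)ᵀᴴ ⊗ₖ A k
  set w : (m × m) × ι → 𝕜 := fun i => vec (1 : Matrix m m 𝕜) i.1
  have hSw : Sᴴ *ᵥ w = vec 1 := by
    rw [conjTranspose_stack_mulVec _ fun _ => vec 1]
    simp only [conjTranspose_kronecker, kronecker_mulVec_vec, ← hA, vec_sum, Matrix.mul_one,
      conjTranspose_conjTranspose, transpose_transpose]
  have hwS : star w ᵥ* S = star (vec 1) := by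
    rw [← hSw, star_mulVec, conjTranspose_conjTranspose]
  have hw := (le_iff.1 hle).dotProduct_mulVec_nonneg w
  rw [sub_mulVec, dotProduct_sub, sub_nonneg, ← mulVec_mulVec, ← mulVec_mulVec, dotProduct_mulVec,
    hSw, hwS, star_dotProduct_blockDiagonal_mulVec _ fun _ => vec 1] at hw
  simpa only [kronecker_mulVec_vec, star_vec_dotProduct_vec, conjTranspose_one, Matrix.mul_one,
    Matrix.one_mul, transpose_transpose] using hw

/-- The quantum affinity `tr (√ρ √σ)` of two positive semidefinite matrices. The trace is real, so
taking its real part only changes the type. -/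
def affinity (ρ σ : Matrix n n ℂ) : ℝ :=
  (CFC.sqrt ρ * CFC.sqrt σ).trace.re

theorem affinity_le_sum_affinity [DecidableEq m] {A : ι → Matrix m n ℂ}
    (hA : ∑ k, (A k)ᴴ * A k = 1) {ρ σ : Matrix n n ℂ} (hρ : ρ.PosSemidef) (hσ : σ.PosSemidef) :
    affinity ρ σ ≤ ∑ k, affinity (A k * ρ * (A k)ᴴ) (A k * σ * (A k)ᴴ) := by
  have hsqrt (M : Matrix n n ℂ) : (CFC.sqrt M).IsHermitian :=
    (CFC.sqrt_nonneg M).posSemidef.isHermitian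
  have hsqrt' (M : Matrix m m ℂ) : (CFC.sqrt M).PosSemidef := (CFC.sqrt_nonneg M).posSemidef
  have hconj {τ : Matrix n n ℂ} (hτ : τ.PosSemidef) (k : ι) :
      CFC.sqrt (A k * τ * (A k)ᴴ) * CFC.sqrt (A k * τ * (A k)ᴴ) =
        A k * (CFC.sqrt τ * CFC.sqrt τ) * (A k)ᴴ := by
    rw [CFC.sqrt_mul_sqrt_self τ hτ.nonneg,
      CFC.sqrt_mul_sqrt_self _ (hτ.mul_mul_conjTranspose_same (A k)).nonneg]
  have h := trace_mul_le_sum_trace_mul hA (hsqrt ρ) (hsqrt σ) (fun _ => hsqrt' _)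
    (fun _ => hsqrt' _) (hconj hρ) (hconj hσ)
  simpa only [affinity, Complex.re_sum] using (Complex.le_def.1 h).1

end Affinity

section Pinching

/-- The pinching `x ↦ ∑ᵢ eᵢ x eᵢ` by a family of idempotents, i.e. the block-diagonal part of `x`
when the `eᵢ` are complete and orthogonal. -/
def pinching {ι R : Type*} [Fintype ι] [Semiring R] (e : ι → R) (x : R) : R :=
  ∑ i, e i * x * e i

section Semiring

variable {ι R : Type*} [Fintype ι] [Semiring R] {e : ι → R}

theorem commute_pinching (he : OrthogonalIdempotents e) (x : R) (i : ι) :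
    Commute (e i) (pinching e x) := by
  classical
  simp only [Commute, SemiconjBy, pinching, Finset.mul_sum, Finset.sum_mul, ← mul_assoc, he.mul_eq]
  simp only [mul_assoc, he.mul_eq]
  simp

theorem pinching_mul_of_commute {y : R} (hy : ∀ i, Commute (e i) y) (x : R) :
    pinching e (x * y) = pinching e x * y := by
  simp only [pinching, Finset.sum_mul, mul_assoc, (hy _).eq]

theorem pinching_eq_self_iff (he : CompleteOrthogonalIdempotents e) {x : R} :
    pinching e x = x ↔ ∀ i, Commute (e i) x := by
  refine ⟨fun h i => h ▸ commute_pinching he.toOrthogonalIdempotents x i, fun h => ?_⟩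
  simp only [pinching, mul_assoc, ← (h _).eq]
  simp only [← mul_assoc, (he.idem _).eq, ← Finset.sum_mul, he.complete, one_mul]

end Semiring

section Matrix

variable {ι n : Type*} [Fintype ι] [Fintype n] [DecidableEq n]

theorem conjTranspose_pinching {α : Type*} [Semiring α] [StarRing α] {e : ι → Matrix n n α}
    (he : ∀ i, (e i).IsHermitian) (X : Matrix n n α) : (pinching e X)ᴴ = pinching e Xᴴ := by
  simp only [pinching, conjTranspose_sum, conjTranspose_mul, (he _).eq, Matrix.mul_assoc]

section Trace

variable {α : Type*} [CommSemiring α] {e : ι → Matrix n n α}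

theorem trace_pinching (he : CompleteOrthogonalIdempotents e) (X : Matrix n n α) :
    (pinching e X).trace = X.trace := by
  simp only [pinching, trace_sum, trace_mul_comm _ (e _), ← Matrix.mul_assoc, (he.idem _).eq]
  rw [← trace_sum, ← Finset.sum_mul, he.complete, Matrix.one_mul]

theorem trace_mul_pinching (he : CompleteOrthogonalIdempotents e) (X Y : Matrix n n α) :
    (X * pinching e Y).trace = (pinching e X * pinching e Y).trace := by
  rw [← pinching_mul_of_commute (commute_pinching he.toOrthogonalIdempotents Y), trace_pinching he]

end Trace

theorem posSemidef_pinching {𝕜 : Type*} [RCLike 𝕜] {e : ι → Matrix n n 𝕜}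
    (he : ∀ i, (e i).IsHermitian) {X : Matrix n n 𝕜} (hX : X.PosSemidef) :
    (pinching e X).PosSemidef :=
  posSemidef_sum _ fun i _ => by
    simpa only [(he i).eq] using hX.mul_mul_conjTranspose_same (e i)

end Matrix

end Pinching

section HilbertSchmidt

variable {n : Type*} [Fintype n]

theorem hsNorm_sq (M : Matrix n n ℂ) : hsNorm M ^ 2 = (Mᴴ * M).trace.re :=
  Real.sq_sqrt (Complex.le_def.1 (posSemidef_conjTranspose_mul_self M).trace_nonneg).1

theorem hsNorm_smul_sq (c : ℝ) (M : Matrix n n ℂ) :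
    hsNorm ((c : ℂ) • M) ^ 2 = c ^ 2 * hsNorm M ^ 2 := by
  simp only [hsNorm_sq, conjTranspose_smul, Complex.star_def, Complex.conj_ofReal, Matrix.smul_mul,
    Matrix.mul_smul, trace_smul, smul_eq_mul, Complex.re_ofReal_mul]
  ring

theorem hsNorm_sub_sq (M N : Matrix n n ℂ) :
    hsNorm (M - N) ^ 2 = hsNorm M ^ 2 + hsNorm N ^ 2 - 2 * (Mᴴ * N).trace.re := by
  have hNM : (Nᴴ * M).trace.re = (Mᴴ * N).trace.re := by
    rw [← conjTranspose_conjTranspose M, ← conjTranspose_mul, trace_conjTranspose,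
      conjTranspose_conjTranspose, Complex.star_def, Complex.conj_re]
  simp only [hsNorm_sq, conjTranspose_sub, sub_mul, mul_sub, trace_sub, Complex.sub_re, hNM]
  ring

theorem two_mul_re_trace_le (M N : Matrix n n ℂ) :
    2 * (Mᴴ * N).trace.re ≤ hsNorm M ^ 2 + hsNorm N ^ 2 := by
  linarith [hsNorm_sub_sq M N, sq_nonneg (hsNorm (M - N))]

variable [DecidableEq n]

theorem hsNorm_sqrt_sq {M : Matrix n n ℂ} (hM : M.PosSemidef) :
    hsNorm (CFC.sqrt M) ^ 2 = M.trace.re := by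
  rw [hsNorm_sq, (CFC.sqrt_nonneg M).posSemidef.isHermitian.eq, CFC.sqrt_mul_sqrt_self M hM.nonneg]

theorem sqrt_smul_of_nonneg {M : Matrix n n ℂ} (hM : M.PosSemidef) {c : ℝ} (hc : 0 ≤ c) :
    CFC.sqrt ((c : ℂ) • M) = (√c : ℂ) • CFC.sqrt M := by
  refine CFC.sqrt_unique ?_
    ((CFC.sqrt_nonneg M).posSemidef.smul (Complex.zero_le_real.2 (Real.sqrt_nonneg c))).nonneg
  rw [smul_mul_smul_comm, CFC.sqrt_mul_sqrt_self M hM.nonneg, ← Complex.ofReal_mul,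
    Real.mul_self_sqrt hc]

variable {ι : Type*} [Fintype ι] {e : ι → Matrix n n ℂ} (he : CompleteOrthogonalIdempotents e)
  (heH : ∀ i, (e i).IsHermitian)

include he heH

theorem hsNorm_sub_pinching_sq (M : Matrix n n ℂ) :
    hsNorm (M - pinching e M) ^ 2 = hsNorm M ^ 2 - hsNorm (pinching e M) ^ 2 := by
  rw [hsNorm_sub_sq, trace_mul_pinching he, ← conjTranspose_pinching heH, ← hsNorm_sq]
  ring

theorem affinity_pinching_sqrt_sq (ρ : Matrix n n ℂ) :
    affinity ρ (pinching e (CFC.sqrt ρ) ^ 2) = hsNorm (pinching e (CFC.sqrt ρ)) ^ 2 := by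
  have hR := (CFC.sqrt_nonneg ρ).posSemidef
  have hD := posSemidef_pinching heH hR
  rw [affinity, pow_two, CFC.sqrt_mul_self _ hD.nonneg, trace_mul_pinching he, hsNorm_sq,
    hD.isHermitian.eq]

theorem two_mul_affinity_le (ρ : Matrix n n ℂ) {σ : Matrix n n ℂ} (hσ : σ.PosSemidef)
    (hσe : pinching e σ = σ) :
    2 * affinity ρ σ ≤ hsNorm (pinching e (CFC.sqrt ρ)) ^ 2 + σ.trace.re := by
  have hsqrt : pinching e (CFC.sqrt σ) = CFC.sqrt σ :=
    (pinching_eq_self_iff he).2 fun i =>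
      (((pinching_eq_self_iff he).1 hσe i).symm.cfcₙ_nnreal NNReal.sqrt).symm
  have hR : (pinching e (CFC.sqrt ρ))ᴴ = pinching e (CFC.sqrt ρ) :=
    (posSemidef_pinching heH (CFC.sqrt_nonneg ρ).posSemidef).isHermitian
  rw [affinity, ← hsqrt, trace_mul_pinching he, hsqrt, ← hsNorm_sqrt_sq hσ]
  simpa only [hR] using two_mul_re_trace_le (pinching e (CFC.sqrt ρ)) (CFC.sqrt σ)

end HilbertSchmidt

section Outcome

variable {n : Type*} [Fintype n]

theorem outcomeProb_nonneg (A : Matrix n n ℂ) {ρ : Matrix n n ℂ} (hρ : ρ.PosSemidef) :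
    0 ≤ outcomeProb A ρ :=
  (Complex.le_def.1 (hρ.mul_mul_conjTranspose_same A).trace_nonneg).1

theorem outcomeProb_smul_outcomeState (A : Matrix n n ℂ) {ρ : Matrix n n ℂ}
    (hρ : ρ.PosSemidef) :
    (outcomeProb A ρ : ℂ) • outcomeState A ρ = A * ρ * Aᴴ := by
  have hM := hρ.mul_mul_conjTranspose_same A
  rcases eq_or_ne (outcomeProb A ρ) 0 with h | h
  · have htr : (A * ρ * Aᴴ).trace = 0 :=
      Complex.ext h (Complex.le_def.1 hM.trace_nonneg).2.symm
    rw [outcomeState, hM.trace_eq_zero_iff.1 htr, smul_zero, smul_zero]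
  · rw [outcomeState, smul_inv_smul₀ (Complex.ofReal_ne_zero.2 h)]

theorem posSemidef_outcomeState (A : Matrix n n ℂ) {ρ : Matrix n n ℂ} (hρ : ρ.PosSemidef) :
    (outcomeState A ρ).PosSemidef := by
  refine (hρ.mul_mul_conjTranspose_same A).smul ?_
  rw [← Complex.ofReal_inv]
  exact Complex.zero_le_real.2 (inv_nonneg.2 (outcomeProb_nonneg A hρ))

theorem isState_inv_trace_smul {σ : Matrix n n ℂ} (hσ : σ.PosSemidef) (hσ0 : σ ≠ 0) :
    IsState (σ.trace⁻¹ • σ) := by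
  refine ⟨hσ.smul (inv_nonneg.2 hσ.trace_nonneg), ?_⟩
  rw [trace_smul, smul_eq_mul, inv_mul_cancel₀ (mt hσ.trace_eq_zero_iff.1 hσ0)]

theorem sum_outcomeProb [DecidableEq n] {ι : Type*} [Fintype ι] {A : ι → Matrix n n ℂ}
    (hA : ∑ k, (A k)ᴴ * A k = 1) (ρ : Matrix n n ℂ) :
    ∑ k, outcomeProb (A k) ρ = ρ.trace.re := by
  simp only [outcomeProb, trace_mul_comm _ (A _)ᴴ, ← Matrix.mul_assoc]
  rw [← Complex.re_sum, ← trace_sum, ← Finset.sum_mul, hA, Matrix.one_mul]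

end Outcome

section WeakMeasurement

variable {a b : Type*} [Fintype a] [DecidableEq a] [Fintype b] [DecidableEq b]
  {P : Fin 2 → Matrix a a ℂ}

theorem localMeasurement_eq_pinching (X : Matrix (a × b) (a × b) ℂ) :
    localMeasurement P X = pinching (fun i => P i ⊗ₖ (1 : Matrix b b ℂ)) X := rfl

theorem IsTwoOutcomeProjective.completeOrthogonalIdempotents_kronecker_one
    (hP : IsTwoOutcomeProjective P) :
    CompleteOrthogonalIdempotents fun i => P i ⊗ₖ (1 : Matrix b b ℂ) where
  idem i := by rw [IsIdempotentElem, ← mul_kronecker_mul, hP.idempotent, Matrix.one_mul]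
  ortho i j hij := by
    change _ * _ = 0
    rw [← mul_kronecker_mul, hP.orthogonal i j hij, zero_kronecker]
  complete := by
    rw [Fin.sum_univ_two, ← add_kronecker, hP.sum_eq_one, one_kronecker_one]

omit [Fintype b] in
theorem IsTwoOutcomeProjective.isHermitian_kronecker_one (hP : IsTwoOutcomeProjective P)
    (i : Fin 2) : (P i ⊗ₖ (1 : Matrix b b ℂ)).IsHermitian := by
  rw [IsHermitian, conjTranspose_kronecker, (hP.isHermitian i).eq, conjTranspose_one]

theorem tau1_sq_add_tau2_sq (x : ℝ) : tau1 x ^ 2 + tau2 x ^ 2 = 1 := by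
  have h₁ := Real.neg_one_lt_tanh x
  have h₂ := Real.tanh_lt_one x
  rw [tau1, tau2, Real.sq_sqrt (by linarith), Real.sq_sqrt (by linarith)]
  ring

theorem sub_weakMeasurement (hP : IsTwoOutcomeProjective P) (x : ℝ)
    (X : Matrix (a × b) (a × b) ℂ) :
    X - weakMeasurement P x X =
      ((1 - 2 * (tau1 x * tau2 x) : ℝ) : ℂ) • (X - localMeasurement P X) := by
  have hτ : (tau2 x : ℂ) ^ 2 = 1 - (tau1 x : ℂ) ^ 2 := by
    rw [eq_sub_iff_add_eq']
    exact_mod_cast tau1_sq_add_tau2_sq x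
  set Q := P 0 ⊗ₖ (1 : Matrix b b ℂ) with hQ
  set T := P 1 ⊗ₖ (1 : Matrix b b ℂ) with hT
  have hQT : Q + T = 1 := by rw [← add_kronecker, hP.sum_eq_one, one_kronecker_one]
  have hX : X = Q * X * Q + Q * X * T + T * X * Q + T * X * T := by
    calc X = (Q + T) * X * (Q + T) := by rw [hQT, Matrix.one_mul, Matrix.mul_one]
      _ = _ := by noncomm_ring
  have hweak : weakMeasurement P x X = Q * X * Q + T * X * T +
      (2 * (tau1 x * tau2 x) : ℂ) • (Q * X * T + T * X * Q) := by
    simp only [weakMeasurement, weakOpPos, weakOpNeg, add_kronecker, smul_kronecker, ← hQ, ← hT,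
      Matrix.add_mul, Matrix.mul_add, Matrix.smul_mul, Matrix.mul_smul]
    match_scalars <;> ring_nf <;> rw [hτ] <;> ring
  have hlocal : localMeasurement P X = Q * X * Q + T * X * T := Fin.sum_univ_two _
  have hoff : X - localMeasurement P X = Q * X * T + T * X * Q := by
    rw [hlocal, sub_eq_iff_eq_add]
    exact hX.trans (by abel)
  rw [hweak, ← hlocal, ← sub_sub, hoff]
  push_cast
  module

omit [DecidableEq a] in
theorem localMeasurement_smul (c : ℂ) (X : Matrix (a × b) (a × b) ℂ) :
    localMeasurement P (c • X) = c • localMeasurement P X := by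
  simp only [localMeasurement, Matrix.mul_smul, Matrix.smul_mul, Finset.smul_sum]

theorem weakCoherence_eq_mul_trace_sub (hP : IsTwoOutcomeProjective P) (x : ℝ)
    {M : Matrix (a × b) (a × b) ℂ} (hM : M.PosSemidef) :
    weakCoherence P x M = (1 - 2 * (tau1 x * tau2 x)) ^ 2 *
      (M.trace.re - hsNorm (localMeasurement P (CFC.sqrt M)) ^ 2) := by
  rw [weakCoherence, sub_weakMeasurement hP, hsNorm_smul_sq, localMeasurement_eq_pinching,
    hsNorm_sub_pinching_sq hP.completeOrthogonalIdempotents_kronecker_one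
      hP.isHermitian_kronecker_one, hsNorm_sqrt_sq hM]

theorem weakCoherence_smul (hP : IsTwoOutcomeProjective P) (x : ℝ)
    {M : Matrix (a × b) (a × b) ℂ} (hM : M.PosSemidef) {c : ℝ} (hc : 0 ≤ c) :
    weakCoherence P x ((c : ℂ) • M) = c * weakCoherence P x M := by
  rw [weakCoherence_eq_mul_trace_sub hP x (hM.smul (Complex.zero_le_real.2 hc)),
    weakCoherence_eq_mul_trace_sub hP x hM, sqrt_smul_of_nonneg hM hc, localMeasurement_smul,
    hsNorm_smul_sq, Real.sq_sqrt hc, trace_smul, smul_eq_mul, Complex.re_ofReal_mul]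
  ring

theorem outcomeProb_mul_weakCoherence (hP : IsTwoOutcomeProjective P) (x : ℝ)
    (A : Matrix (a × b) (a × b) ℂ) {ρ : Matrix (a × b) (a × b) ℂ} (hρ : ρ.PosSemidef) :
    outcomeProb A ρ * weakCoherence P x (outcomeState A ρ) = weakCoherence P x (A * ρ * Aᴴ) := by
  rw [← weakCoherence_smul hP x (posSemidef_outcomeState A hρ) (outcomeProb_nonneg A hρ),
    outcomeProb_smul_outcomeState A hρ]

variable {ι : Type*} [Fintype ι] {A : ι → Matrix (a × b) (a × b) ℂ}

theorem IsPartiallyIncoherentKraus.localMeasurement_conj_of_mem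
    (hA : IsPartiallyIncoherentKraus P A) (k : ι) {σ : Matrix (a × b) (a × b) ℂ}
    (hσ : σ ∈ partiallyIncoherentStates P) :
    localMeasurement P (A k * σ * (A k)ᴴ) = A k * σ * (A k)ᴴ := by
  rw [← outcomeProb_smul_outcomeState (A k) hσ.1.1, localMeasurement_smul]
  rcases eq_or_ne (outcomeProb (A k) σ) 0 with h | h
  · rw [h, Complex.ofReal_zero, zero_smul, zero_smul]
  · rw [(hA.incoherent k σ hσ h).2]

theorem IsPartiallyIncoherentKraus.localMeasurement_conj (hA : IsPartiallyIncoherentKraus P A)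
    (k : ι) {σ : Matrix (a × b) (a × b) ℂ} (hσ : σ.PosSemidef) (hσP : localMeasurement P σ = σ) :
    localMeasurement P (A k * σ * (A k)ᴴ) = A k * σ * (A k)ᴴ := by
  rcases eq_or_ne σ 0 with rfl | hσ0
  · simpa only [Matrix.mul_zero, Matrix.zero_mul] using hσP
  have hmem : σ.trace⁻¹ • σ ∈ partiallyIncoherentStates P :=
    ⟨isState_inv_trace_smul hσ hσ0, by rw [localMeasurement_smul, hσP]⟩
  have h := hA.localMeasurement_conj_of_mem k hmem
  rw [Matrix.mul_smul, Matrix.smul_mul, localMeasurement_smul] at h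
  exact smul_right_injective _ (inv_ne_zero (mt hσ.trace_eq_zero_iff.1 hσ0)) h

theorem sq_hsNorm_localMeasurement_sqrt_le (hP : IsTwoOutcomeProjective P)
    (hA : IsPartiallyIncoherentKraus P A) {ρ : Matrix (a × b) (a × b) ℂ} (hρ : ρ.PosSemidef) :
    hsNorm (localMeasurement P (CFC.sqrt ρ)) ^ 2 ≤
      ∑ k, hsNorm (localMeasurement P (CFC.sqrt (A k * ρ * (A k)ᴴ))) ^ 2 := by
  have he := hP.completeOrthogonalIdempotents_kronecker_one (b := b)
  have heH := hP.isHermitian_kronecker_one (b := b)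
  set D := localMeasurement P (CFC.sqrt ρ)
  have hDpos : D.PosSemidef := posSemidef_pinching heH (CFC.sqrt_nonneg ρ).posSemidef
  have hσ : (D ^ 2).PosSemidef := hDpos.pow 2
  have hσP : localMeasurement P (D ^ 2) = D ^ 2 :=
    (pinching_eq_self_iff he).2 fun i =>
      (commute_pinching he.toOrthogonalIdempotents (CFC.sqrt ρ) i).pow_right 2
  have hattained : affinity ρ (D ^ 2) = hsNorm D ^ 2 := affinity_pinching_sqrt_sq he heH ρ
  have htrace : (D ^ 2).trace.re = hsNorm D ^ 2 := by
    rw [hsNorm_sq, hDpos.isHermitian.eq, pow_two]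
  have hbound (k : ι) : 2 * affinity (A k * ρ * (A k)ᴴ) (A k * D ^ 2 * (A k)ᴴ) ≤
      hsNorm (localMeasurement P (CFC.sqrt (A k * ρ * (A k)ᴴ))) ^ 2 + outcomeProb (A k) (D ^ 2) :=
    two_mul_affinity_le he heH _ (hσ.mul_mul_conjTranspose_same (A k))
      (hA.localMeasurement_conj k hσ hσP)
  have hsum := Finset.sum_le_sum fun k (_ : k ∈ Finset.univ) => hbound k
  rw [← Finset.mul_sum, Finset.sum_add_distrib, sum_outcomeProb hA.tracePreserving, htrace] at hsum
  linarith [affinity_le_sum_affinity hA.tracePreserving hρ hσ]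

end WeakMeasurement

end WeakCoherence

end

theorem mainTheorem4 {a b ι : Type*} [Fintype a] [DecidableEq a] [Fintype b] [DecidableEq b]
    [Fintype ι]
    (P : Fin 2 → Matrix a a ℂ) (hP : WeakCoherence.IsTwoOutcomeProjective P) (x : ℝ)
    (ρ : Matrix (a × b) (a × b) ℂ) (hρ : WeakCoherence.IsState ρ)
    (A : ι → Matrix (a × b) (a × b) ℂ)
    (hA : WeakCoherence.IsPartiallyIncoherentKraus P A) :
    ∑ k, WeakCoherence.outcomeProb (A k) ρ *
        WeakCoherence.weakCoherence P x (WeakCoherence.outcomeState (A k) ρ) ≤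
      WeakCoherence.weakCoherence P x ρ := by
  have hmono := WeakCoherence.sq_hsNorm_localMeasurement_sqrt_le hP hA hρ.1
  simp only [WeakCoherence.outcomeProb_mul_weakCoherence hP x _ hρ.1,
    WeakCoherence.weakCoherence_eq_mul_trace_sub hP x hρ.1,
    WeakCoherence.weakCoherence_eq_mul_trace_sub hP x (hρ.1.mul_mul_conjTranspose_same _)]
  rw [← Finset.mul_sum, Finset.sum_sub_distrib]
  change _ * (∑ k, WeakCoherence.outcomeProb (A k) ρ - _) ≤ _
  rw [WeakCoherence.sum_outcomeProb hA.tracePreserving]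
  exact mul_le_mul_of_nonneg_left (sub_le_sub_left hmono _) (sq_nonneg _)
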